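/- For $x\in\mathbb{R}^2$, $r>0$, $0<\alpha<1$ and a one-dimensional linear subspace $\ell$ of $\mathbb{R}^2$ (that is, $\ell\in G(2,1)$), let $B(x,r)$ be the closed Euclidean ball and $$X(x,r,\ell,\alpha)=\{y\in B(x,r) : \operatorname{dist}(y-x,\ell)<\alpha|y-x|\}.$$ By a $C^1$ curve we mean a regular one, i.e. the image of a $C^1$ map $\gamma:\mathbb{R}\to\mathbb{R}^2$ with $\gamma'(t)\neq 0$ for all $t$. Call a set $A\subset\mathbb{R}^2$ $1$-rectifiable if it is covered by countably many $C^1$ curves (no exceptional set is allowed), and call a measure $\mu$ on $\mathbb{R}^2$ purely $1$-unrectifiable if $\mu(A)=0$ for every $1$-rectifiable set $A\subset\mathbb{R}^2$. There exist a line $\ell\in G(2,1)$ and a finite nontrivial Borel measure $\mu$ on $\mathbb{R}^2$ such that $\mu$ is purely $1$-unrectifiable and, for every $0<\alpha<1$, $$\lim_{r\downarrow 0}\frac{\mu\bigl(X(x,r,\ell,\alpha)\bigr)}{\mu\bigl(B(x,r)\bigr)}=0\qquad\text{for }\mu\text{-almost every }x\in\mathbb{R}^2 .$$ -/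

import Mathlib

open Filter Topology MeasureTheory

/-- The Euclidean plane. -/
abbrev Plane : Type := EuclideanSpace ℝ (Fin 2)

/-- `V ∈ G(2,1)`: a one-dimensional linear subspace of the plane. -/
def IsLine (V : Submodule ℝ Plane) : Prop := Module.finrank ℝ V = 1

/-- The cone `X(x,V,α) = {y : dist(y - x, V) < α |y - x|}`. -/
def cone (x : Plane) (V : Submodule ℝ Plane) (α : ℝ) : Set Plane :=
  {y | Metric.infDist (y - x) (V : Set Plane) < α * ‖y - x‖}

/-- The truncated cone `X(x,r,V,α) = B(x,r) ∩ X(x,V,α)`, with `B(x,r)` the closed ball. -/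
def truncCone (x : Plane) (r : ℝ) (V : Submodule ℝ Plane) (α : ℝ) : Set Plane :=
  Metric.closedBall x r ∩ cone x V α

/-- A (regular) parametrised `C¹` curve in the plane. -/
structure IsC1Curve (γ : ℝ → Plane) : Prop where
  contDiff : ContDiff ℝ 1 γ
  deriv_ne_zero : ∀ t, deriv γ t ≠ 0

/-- `1`-rectifiable: covered by countably many `C¹` curves. There is no exceptional set, because
the notion is used for measures that need not be absolutely continuous with respect to
one-dimensional Hausdorff measure. -/
def IsOneRectifiable (A : Set Plane) : Prop :=
  ∃ γ : ℕ → ℝ → Plane, (∀ i, IsC1Curve (γ i)) ∧ A ⊆ ⋃ i, Set.range (γ i)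

/-- Purely `1`-unrectifiable measures: all `1`-rectifiable sets are null. -/
def PurelyOneUnrectifiable (μ : Measure Plane) : Prop :=
  ∀ A : Set Plane, IsOneRectifiable A → μ A = 0

/-- Digits of configuration `k`: a height and a column. -/
abbrev Digit (k : ℕ) : Type := Fin (k * (2 * k + 4) + 2) × Bool

/-- Horizontal coordinate of the point with a given digit. -/
def digitX {k : ℕ} (d : Digit k) : ℝ := if d.2 then 2 * k + 4 else 0

/-- Vertical coordinate of the point with a given digit: one column goes down, the other up. -/
def digitY {k : ℕ} (d : Digit k) : ℝ := if d.2 then (d.1 : ℕ) else -((d.1 : ℕ) : ℝ)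

/-- The unnormalised weight of a digit. -/
def digitWeight {k : ℕ} (d : Digit k) : ℕ := (k + 2) ^ (d.1 : ℕ)

/-- The total weight of configuration `k`. -/
def totalWeight (k : ℕ) : ℕ := ∑ d : Digit k, digitWeight d

lemma digitWeight_pos {k : ℕ} (d : Digit k) : 0 < digitWeight d := by
  unfold digitWeight; positivity

lemma totalWeight_pos (k : ℕ) : 0 < totalWeight k :=
  Finset.sum_pos (fun d _ => digitWeight_pos d) ⟨((0 : Fin _), true), Finset.mem_univ _⟩

lemma totalWeight_zero : totalWeight 0 = 6 := by
  unfold totalWeight digitWeight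
  decide

/-- The probability distribution of a digit. -/
noncomputable def digitPMF (k : ℕ) : PMF (Digit k) :=
  PMF.ofFintype (fun d => (digitWeight d : ENNReal) / totalWeight k) (by
    simp_rw [div_eq_mul_inv]
    rw [← Finset.sum_mul, ← Nat.cast_sum]
    exact ENNReal.mul_inv_cancel (by exact_mod_cast (totalWeight_pos k).ne')
      (ENNReal.natCast_ne_top _))

/-- The distribution of a digit as a measure. -/
noncomputable def digitMeasure (k : ℕ) : Measure (Digit k) := (digitPMF k).toMeasure

instance (k : ℕ) : IsProbabilityMeasure (digitMeasure k) :=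
  PMF.toMeasure.isProbabilityMeasure _

lemma digitMeasure_finset {k : ℕ} (s : Finset (Digit k)) :
    digitMeasure k s = (∑ d ∈ s, digitWeight d : ℕ) / totalWeight k := by
  rw [digitMeasure, PMF.toMeasure_apply_finset]
  simp only [digitPMF, PMF.ofFintype_apply, div_eq_mul_inv]
  rw [← Finset.sum_mul, ← Nat.cast_sum]

lemma digitMeasure_singleton {k : ℕ} (d : Digit k) :
    digitMeasure k {d} = digitWeight d / totalWeight k := by
  have := digitMeasure_finset {d}
  simpa using this

lemma one_le_digitMeasure_singleton_mul {k : ℕ} (d : Digit k) :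
    1 ≤ digitMeasure k {d} * totalWeight k := by
  rw [digitMeasure_singleton, ENNReal.div_mul_cancel
    (by exact_mod_cast (totalWeight_pos k).ne') (ENNReal.natCast_ne_top _)]
  exact_mod_cast digitWeight_pos d

lemma digitMeasure_singleton_le {k : ℕ} (d : Digit k) : digitMeasure k {d} ≤ 2⁻¹ := by
  have h : 2 * digitWeight d ≤ totalWeight k := by
    have h1 : ({d, (d.1, !d.2)} : Finset (Digit k)) ⊆ Finset.univ := Finset.subset_univ _
    have h2 := Finset.sum_le_sum_of_subset (f := digitWeight) h1
    rw [Finset.sum_pair (by intro h; have := congrArg Prod.snd h; simp at this)] at h2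
    have h3 : digitWeight (d.1, !d.2) = digitWeight d := rfl
    unfold totalWeight
    omega
  rw [digitMeasure_singleton]
  apply ENNReal.div_le_of_le_mul
  rw [mul_comm, ← div_eq_mul_inv, ENNReal.le_div_iff_mul_le (by simp) (by simp)]
  rw [mul_comm]
  exact_mod_cast h

/-- The weights of one column up to some height are dominated by the next weight. -/
lemma digitMeasure_le_of_height_lt {k : ℕ} (i : ℕ) (b : Bool) (m : Digit k)
    (hm : i < (m.1 : ℕ)) :
    digitMeasure k {d | d.2 = b ∧ (d.1 : ℕ) ≤ i} ≤ (k + 1 : ENNReal)⁻¹ * digitMeasure k {m} := by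
  classical
  have e : {d : Digit k | d.2 = b ∧ (d.1 : ℕ) ≤ i} =
      ((Finset.univ.filter fun d : Digit k => d.2 = b ∧ (d.1 : ℕ) ≤ i : Finset _) : Set _) := by
    ext; simp
  rw [e, digitMeasure_finset, digitMeasure_singleton]
  have h : (k + 1) * (∑ d ∈ Finset.univ.filter fun d : Digit k => d.2 = b ∧ (d.1 : ℕ) ≤ i,
      digitWeight d) ≤ digitWeight m := by
    have h1 : (∑ d ∈ Finset.univ.filter fun d : Digit k => d.2 = b ∧ (d.1 : ℕ) ≤ i,
        digitWeight d) ≤ ∑ j ∈ Finset.range (i + 1), (k + 2) ^ j := by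
      unfold digitWeight
      rw [← Finset.sum_image (f := fun j => (k + 2) ^ j)
        (s := Finset.univ.filter fun d : Digit k => d.2 = b ∧ (d.1 : ℕ) ≤ i)
        (g := fun d : Digit k => (d.1 : ℕ))]
      · apply Finset.sum_le_sum_of_subset
        intro j hj
        simp only [Finset.mem_image, Finset.mem_filter] at hj
        obtain ⟨d, ⟨-, -, hd⟩, rfl⟩ := hj
        exact Finset.mem_range.2 (by omega)
      · intro d hd d' hd' h
        simp only [Finset.coe_filter, Finset.mem_univ, true_and, Set.mem_ofPred_eq] at hd hd'
        exact Prod.ext (Fin.ext h) (hd.1.trans hd'.1.symm)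
    have h2 := Nat.geomSum_eq (m := k + 2) (by omega) (i + 1)
    have h3 : (k + 1) * ∑ j ∈ Finset.range (i + 1), (k + 2) ^ j ≤ (k + 2) ^ (i + 1) := by
      rw [h2]
      exact (Nat.mul_div_le _ _).trans (Nat.sub_le _ _)
    calc _ ≤ _ := Nat.mul_le_mul_left _ h1
      _ ≤ _ := h3
      _ ≤ _ := Nat.pow_le_pow_right (by omega) hm
  generalize (∑ d ∈ Finset.univ.filter fun d : Digit k => d.2 = b ∧ (d.1 : ℕ) ≤ i,
      digitWeight d) = S at h ⊢
  rw [← mul_div_assoc]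
  gcongr
  rw [mul_comm, ← div_eq_mul_inv, ENNReal.le_div_iff_mul_le (by simp) (by simp), mul_comm]
  exact_mod_cast h

lemma abs_digitY_le {k : ℕ} (d : Digit k) : |digitY d| ≤ k * (2 * k + 4) + 1 := by
  have h : ((d.1 : ℕ) : ℝ) ≤ k * (2 * k + 4) + 1 := by
    have := d.1.2
    exact_mod_cast (by omega : (d.1 : ℕ) ≤ k * (2 * k + 4) + 1)
  have h0 : (0 : ℝ) ≤ (d.1 : ℕ) := Nat.cast_nonneg _
  unfold digitY
  split_ifs
  · rwa [abs_of_nonneg h0]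
  · rwa [abs_neg, abs_of_nonneg h0]

/-- A bound for the coordinates of configuration `k`. -/
def digitBound (k : ℕ) : ℝ := k * (2 * k + 4) + 2 * k + 4

lemma one_le_digitBound (k : ℕ) : 1 ≤ digitBound k := by
  unfold digitBound
  have : (0 : ℝ) ≤ k := k.cast_nonneg
  nlinarith

lemma abs_digitX_le_bound {k : ℕ} (d : Digit k) : |digitX d| ≤ digitBound k := by
  have : (0 : ℝ) ≤ k := k.cast_nonneg
  unfold digitX digitBound
  rw [abs_le]
  split_ifs <;> constructor <;> nlinarith

lemma abs_digitY_le_bound {k : ℕ} (d : Digit k) : |digitY d| ≤ digitBound k := by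
  refine (abs_digitY_le d).trans ?_
  have : (0 : ℝ) ≤ k := k.cast_nonneg
  unfold digitBound
  linarith

/-- The relative size of the cells of the next level. -/
noncomputable def cellSize (k : ℕ) : ℝ := 1 / (4 * (k + 1))

lemma cellSize_pos (k : ℕ) : 0 < cellSize k := by unfold cellSize; positivity

lemma cellSize_mul (k : ℕ) : (k + 1) * cellSize k = 1 / 4 := by
  unfold cellSize; field_simp

lemma cellSize_le (k : ℕ) : cellSize k ≤ 1 / 4 := by
  have h0 : (0 : ℝ) ≤ k := k.cast_nonneg
  have := cellSize_mul k
  have := cellSize_pos k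
  nlinarith

/-- Points of the other column seen in a flat cone are low. -/
lemma height_add_le_of_flat {k : ℕ} {d d' : Digit k} (hd : d ≠ d') {x y : ℝ}
    (hx : |x - (digitX d' - digitX d)| ≤ cellSize k)
    (hy : |y - (digitY d' - digitY d)| ≤ cellSize k) (h : |y| ≤ k * |x|) :
    d'.2 = !d.2 ∧ (d.1 : ℕ) + (d'.1 : ℕ) ≤ k * (2 * k + 4) := by
  have h0 : (0 : ℝ) ≤ k := k.cast_nonneg
  have hm := cellSize_mul k
  have hp := cellSize_pos k
  have hl := cellSize_le k
  obtain ⟨i, b⟩ := d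
  obtain ⟨j, b'⟩ := d'
  by_cases hb : b = b'
  · exfalso
    subst hb
    have hij : (i : ℕ) ≠ j := fun e => hd (by rw [Fin.ext e])
    have h1 : (1 : ℝ) ≤ |digitY ((j, b) : Digit k) - digitY ((i, b) : Digit k)| := by
      have : (1 : ℤ) ≤ |(j : ℕ) - ((i : ℕ) : ℤ)| := by
        apply Int.one_le_abs; omega
      have h2 : (1 : ℝ) ≤ |((j : ℕ) : ℝ) - ((i : ℕ) : ℝ)| := by exact_mod_cast this
      unfold digitY
      cases b
      · simp only [Bool.false_eq_true, if_false]
        rwa [neg_sub_neg, abs_sub_comm]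
      · simpa using h2
    have h2 : digitX ((j, b) : Digit k) - digitX ((i, b) : Digit k) = 0 := by simp [digitX]
    rw [h2, sub_zero] at hx
    have h3 := abs_sub_abs_le_abs_sub (digitY ((j, b) : Digit k) - digitY ((i, b) : Digit k)) y
    rw [abs_sub_comm] at hy
    have := mul_le_mul_of_nonneg_left hx h0
    nlinarith
  · have hb' : b' = !b := by cases b <;> cases b' <;> simp_all
    refine ⟨hb', ?_⟩
    subst hb'
    have h1 : |digitX ((j, !b) : Digit k) - digitX ((i, b) : Digit k)| = 2 * k + 4 := by
      unfold digitX; cases b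
      · simp only [Bool.not_false, Bool.false_eq_true, if_false, if_true, sub_zero]
        exact abs_of_nonneg (by positivity)
      · simp only [Bool.not_true, Bool.false_eq_true, if_false, if_true, zero_sub, abs_neg]
        exact abs_of_nonneg (by positivity)
    have h2 : |digitY ((j, !b) : Digit k) - digitY ((i, b) : Digit k)| = (i : ℕ) + (j : ℕ) := by
      unfold digitY; cases b
      · simp only [Bool.not_false, Bool.false_eq_true, if_false, if_true]
        rw [abs_of_nonneg (by have : (0 : ℝ) ≤ (i : ℕ) := Nat.cast_nonneg _
                              have : (0 : ℝ) ≤ (j : ℕ) := Nat.cast_nonneg _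
                              linarith)]
        ring
      · simp only [Bool.not_true, Bool.false_eq_true, if_false, if_true]
        rw [abs_of_nonpos (by have : (0 : ℝ) ≤ (i : ℕ) := Nat.cast_nonneg _
                              have : (0 : ℝ) ≤ (j : ℕ) := Nat.cast_nonneg _
                              linarith)]
        ring
    have h3 := abs_sub_abs_le_abs_sub
      (digitY ((j, !b) : Digit k) - digitY ((i, b) : Digit k)) y
    have h4 := abs_sub_abs_le_abs_sub x
      (digitX ((j, !b) : Digit k) - digitX ((i, b) : Digit k))
    rw [abs_sub_comm] at hy
    have h5 : |x| ≤ 2 * k + 4 + cellSize k := by linarith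
    have h6 := mul_le_mul_of_nonneg_left h5 h0
    have h7 : (((i : ℕ) + (j : ℕ) : ℕ) : ℝ) < ((k * (2 * k + 4) + 1 : ℕ) : ℝ) := by
      push_cast; nlinarith
    have h8 : (i : ℕ) + (j : ℕ) < k * (2 * k + 4) + 1 := by exact_mod_cast h7
    simp only
    omega

lemma sq_add_sq_le_of_abs_bounds {κ η s x y x' y' : ℝ} (h0 : 0 ≤ κ) (hp : 0 < η)
    (hms : (κ + 1) * η = 1 / 4) (hl : η ≤ 1 / 4) (hs0 : 0 ≤ s) (hsk : s ≤ κ * (2 * κ + 4))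
    (ax' : |x'| ≤ η) (ay' : |y'| ≤ s + 1 + η) (ax : 2 * κ + 4 - η ≤ |x|) (ay : s - η ≤ |y|) :
    x' ^ 2 + y' ^ 2 ≤ x ^ 2 + y ^ 2 := by
  have sx' : x' ^ 2 ≤ η ^ 2 := sq_le_sq' (by linarith [(abs_le.1 ax').1]) (abs_le.1 ax').2
  have sy' : y' ^ 2 ≤ (s + 1 + η) ^ 2 := sq_le_sq' (by linarith [(abs_le.1 ay').1]) (abs_le.1 ay').2
  have sx : (2 * κ + 4 - η) ^ 2 ≤ x ^ 2 := by
    rw [← sq_abs x]; exact pow_le_pow_left₀ (by linarith) ax 2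
  have sy : s ^ 2 - 2 * s * η ≤ y ^ 2 := by
    rw [← sq_abs y]
    rcases le_total s η with h | h
    · nlinarith [sq_nonneg |y|]
    · nlinarith [pow_le_pow_left₀ (by linarith) ay 2]
  have e1 : s * η ≤ (2 * κ + 4) * (1 / 4) := by
    have : s * η ≤ κ * (2 * κ + 4) * η := mul_le_mul_of_nonneg_right hsk hp.le
    have : (2 * κ + 4) * (κ * η) ≤ (2 * κ + 4) * (1 / 4) :=
      mul_le_mul_of_nonneg_left (by linarith) (by linarith)
    linarith
  have e2 : η * (2 * κ + 4) ≤ 1 := by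
    have : η * (2 * κ + 4) = 2 * ((κ + 1) * η) + 2 * η := by ring
    linarith
  have e3 : η ^ 2 ≤ 1 := by nlinarith
  have e4 : (2 * κ + 4 - η) ^ 2 = 2 * (κ * (2 * κ + 4)) + 4 * (2 * κ + 4)
      - 2 * (η * (2 * κ + 4)) + η ^ 2 := by ring
  have e5 : (s + 1 + η) ^ 2 = s ^ 2 + 2 * s + 1 + 2 * (s * η) + 2 * η + η ^ 2 := by ring
  linarith

/-- From a point of one column, every low point of the other column is farther away than the
points of the first column which are at most one step higher. -/
lemma sq_add_sq_le_of_height {k : ℕ} {d d' m : Digit k} (hb : d'.2 = !d.2) (hm : m.2 = d.2)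
    (hle : (d.1 : ℕ) + (d'.1 : ℕ) ≤ k * (2 * k + 4)) (h1 : (d.1 : ℕ) ≤ m.1)
    (h2 : (m.1 : ℕ) ≤ 2 * d.1 + d'.1 + 1) {x y x' y' : ℝ}
    (hx : |x - (digitX d' - digitX d)| ≤ cellSize k)
    (hy : |y - (digitY d' - digitY d)| ≤ cellSize k)
    (hx' : |x' - (digitX m - digitX d)| ≤ cellSize k)
    (hy' : |y' - (digitY m - digitY d)| ≤ cellSize k) :
    x' ^ 2 + y' ^ 2 ≤ x ^ 2 + y ^ 2 := by
  have h0 : (0 : ℝ) ≤ k := k.cast_nonneg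
  have hms := cellSize_mul k
  have hp := cellSize_pos k
  have hl := cellSize_le k
  obtain ⟨i, b⟩ := d
  obtain ⟨j, b'⟩ := d'
  obtain ⟨l, b''⟩ := m
  simp only at hb hm hle h1 h2
  subst hb hm
  obtain ⟨s, hs⟩ : ∃ s : ℝ, s = (i : ℕ) + (j : ℕ) := ⟨_, rfl⟩
  have hi : (0 : ℝ) ≤ (i : ℕ) := Nat.cast_nonneg _
  have hj : (0 : ℝ) ≤ (j : ℕ) := Nat.cast_nonneg _
  have hs0 : 0 ≤ s := by linarith
  have hsk : s ≤ k * (2 * k + 4) := by rw [hs]; exact_mod_cast hle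
  have h1' : ((i : ℕ) : ℝ) ≤ (l : ℕ) := by exact_mod_cast h1
  have h2' : ((l : ℕ) : ℝ) ≤ 2 * (i : ℕ) + (j : ℕ) + 1 := by exact_mod_cast h2
  have ax' : |x'| ≤ cellSize k := by simpa [digitX] using hx'
  have ay' : |y'| ≤ s + 1 + cellSize k := by
    unfold digitY at hy'
    rw [abs_le] at hy' ⊢
    cases b'' <;> simp only [Bool.false_eq_true, if_false, if_true] at hy' <;>
      constructor <;> linarith
  have ax : 2 * k + 4 - cellSize k ≤ |x| := by
    unfold digitX at hx
    rw [abs_le] at hx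
    rw [le_abs]
    cases b'' <;> simp only [Bool.not_true, Bool.not_false, Bool.false_eq_true, if_false,
      if_true] at hx
    · left; linarith
    · right; linarith
  have ay : s - cellSize k ≤ |y| := by
    unfold digitY at hy
    rw [abs_le] at hy
    rw [le_abs]
    cases b'' <;> simp only [Bool.not_true, Bool.not_false, Bool.false_eq_true, if_false,
      if_true] at hy
    · left; linarith
    · right; linarith
  exact sq_add_sq_le_of_abs_bounds h0 hp hms hl hs0 hsk ax' ay' ax ay

/-- Sequences of digits. -/
abbrev Code (c : ℕ → ℕ) : Type := ∀ n, Digit (c n)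

/-- The scale of the cells of level `n`. -/
noncomputable def scale (c : ℕ → ℕ) : ℕ → ℝ
  | 0 => 1
  | n + 1 => scale c n * cellSize (c n) / (4 * digitBound (c (n + 1)))

lemma digitBound_pos (k : ℕ) : 0 < digitBound k := zero_lt_one.trans_le (one_le_digitBound k)

lemma scale_pos (c : ℕ → ℕ) (n : ℕ) : 0 < scale c n := by
  induction n with
  | zero => exact one_pos
  | succ n ih =>
    have := cellSize_pos (c n)
    have := digitBound_pos (c (n + 1))
    rw [scale]; positivity

lemma scale_succ_mul_digitBound (c : ℕ → ℕ) (n : ℕ) :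
    scale c (n + 1) * (2 * digitBound (c (n + 1))) = scale c n * cellSize (c n) / 2 := by
  have := (digitBound_pos (c (n + 1))).ne'
  rw [scale]; field_simp; norm_num

lemma scale_mul_digitBound_le (c : ℕ → ℕ) (n j : ℕ) :
    scale c (j + (n + 1)) * (2 * digitBound (c (j + (n + 1)))) ≤
      scale c n * cellSize (c n) / 2 / 2 ^ j := by
  induction j with
  | zero => rw [zero_add, scale_succ_mul_digitBound]; simp
  | succ j ih =>
    rw [show j + 1 + (n + 1) = j + (n + 1) + 1 by ring, scale_succ_mul_digitBound, pow_succ,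
      ← div_div]
    have h1 := cellSize_le (c (j + (n + 1)))
    have h2 := one_le_digitBound (c (j + (n + 1)))
    have h3 := scale_pos c (j + (n + 1))
    have : scale c (j + (n + 1)) * cellSize (c (j + (n + 1))) ≤
        scale c (j + (n + 1)) * (2 * digitBound (c (j + (n + 1)))) :=
      mul_le_mul_of_nonneg_left (by linarith) h3.le
    linarith

lemma scale_antitone (c : ℕ → ℕ) : Antitone (scale c) := by
  refine antitone_nat_of_succ_le fun n => ?_
  have h1 := scale_succ_mul_digitBound c n
  have h2 := one_le_digitBound (c (n + 1))
  have h3 := scale_pos c n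
  have h4 := scale_pos c (n + 1)
  have h5 := cellSize_le (c n)
  have h6 := cellSize_pos (c n)
  nlinarith

lemma summable_scale_mul_digitBound (c : ℕ → ℕ) :
    Summable fun n => scale c n * digitBound (c n) := by
  rw [← summable_nat_add_iff 1]
  have h : Summable fun j : ℕ => scale c 0 * cellSize (c 0) / 2 / 2 ^ j :=
    (hasSum_geometric_two' _).summable
  refine Summable.of_nonneg_of_le (fun j => ?_) (fun j => ?_) h
  · have := scale_pos c (j + 1)
    have := digitBound_pos (c (j + 1))
    positivity
  · refine le_trans ?_ (scale_mul_digitBound_le c 0 j)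
    have := scale_pos c (j + (0 + 1))
    have := digitBound_pos (c (j + (0 + 1)))
    have : 0 < scale c (j + (0 + 1)) * digitBound (c (j + (0 + 1))) := by positivity
    simp only [zero_add] at this ⊢
    linarith

/-- A coordinate of the point with a given code. -/
noncomputable def codeCoord (c : ℕ → ℕ) (f : ∀ k, Digit k → ℝ) (ω : Code c) : ℝ :=
  ∑' n, scale c n * f (c n) (ω n)

section codeCoord

variable {c : ℕ → ℕ} {f : ∀ k, Digit k → ℝ}

lemma norm_scale_mul_le (hf : ∀ k d, |f k d| ≤ digitBound k) (n : ℕ) (ω : Code c) :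
    ‖scale c n * f (c n) (ω n)‖ ≤ scale c n * digitBound (c n) := by
  rw [norm_mul, Real.norm_eq_abs, Real.norm_eq_abs, abs_of_pos (scale_pos c n)]
  exact mul_le_mul_of_nonneg_left (hf _ _) (scale_pos c n).le

lemma summable_codeCoord (hf : ∀ k d, |f k d| ≤ digitBound k) (ω : Code c) :
    Summable fun n => scale c n * f (c n) (ω n) :=
  Summable.of_norm_bounded (summable_scale_mul_digitBound c) (norm_scale_mul_le hf · ω)

lemma continuous_codeCoord (hf : ∀ k d, |f k d| ≤ digitBound k) :
    Continuous (codeCoord c f) := by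
  refine continuous_tsum (fun n => ?_) (summable_scale_mul_digitBound c) (norm_scale_mul_le hf)
  exact continuous_const.mul ((continuous_of_discreteTopology (f := f (c n))).comp
    (continuous_apply n))

/-- The relative position of two codes is up to a small error given by the first digit in which
they may differ. -/
lemma abs_codeCoord_sub_le (hf : ∀ k d, |f k d| ≤ digitBound k) {ω ω' : Code c} {n : ℕ}
    (h : ∀ k < n, ω' k = ω k) :
    |(codeCoord c f ω' - codeCoord c f ω) / scale c n - (f (c n) (ω' n) - f (c n) (ω n))| ≤
      cellSize (c n) := by
  have hs := scale_pos c n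
  have h1 : codeCoord c f ω' - codeCoord c f ω =
      ∑' k, scale c k * (f (c k) (ω' k) - f (c k) (ω k)) := by
    simp_rw [mul_sub]
    exact ((summable_codeCoord hf ω').tsum_sub (summable_codeCoord hf ω)).symm
  have hsum : Summable fun k => scale c k * (f (c k) (ω' k) - f (c k) (ω k)) := by
    simp_rw [mul_sub]
    exact (summable_codeCoord hf ω').sub (summable_codeCoord hf ω)
  have h2 := hsum.sum_add_tsum_nat_add (n + 1)
  rw [Finset.sum_range_succ, Finset.sum_eq_zero (fun k hk => by
    rw [h k (Finset.mem_range.1 hk), sub_self, mul_zero]), zero_add] at h2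
  have h3 : ‖∑' j, scale c (j + (n + 1)) *
      (f (c (j + (n + 1))) (ω' (j + (n + 1))) - f (c (j + (n + 1))) (ω (j + (n + 1))))‖ ≤
      scale c n * cellSize (c n) := by
    refine tsum_of_norm_bounded (hasSum_geometric_two' (scale c n * cellSize (c n))) fun j => ?_
    refine le_trans ?_ (scale_mul_digitBound_le c n j)
    rw [norm_mul, Real.norm_eq_abs, Real.norm_eq_abs, abs_of_pos (scale_pos c _)]
    refine mul_le_mul_of_nonneg_left ?_ (scale_pos c _).le
    refine (abs_sub _ _).trans ?_
    linarith [hf _ (ω' (j + (n + 1))), hf _ (ω (j + (n + 1)))]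
  rw [h1, ← h2, add_div, mul_div_cancel_left₀ _ hs.ne', add_sub_cancel_left, abs_div,
    abs_of_pos hs, div_le_iff₀ hs, mul_comm]
  exact h3

end codeCoord

/-- The point of the plane with a given code. -/
noncomputable def codePoint (c : ℕ → ℕ) (ω : Code c) : Plane :=
  !₂[codeCoord c (fun _ => digitX) ω, codeCoord c (fun _ => digitY) ω]

lemma continuous_codePoint (c : ℕ → ℕ) : Continuous (codePoint c) := by
  refine (PiLp.continuous_toLp 2 _).comp (continuous_pi fun i => ?_)
  fin_cases i
  · exact continuous_codeCoord fun _ => abs_digitX_le_bound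
  · exact continuous_codeCoord fun _ => abs_digitY_le_bound

lemma abs_codePoint_zero_sub_le {c : ℕ → ℕ} {ω ω' : Code c} {n : ℕ} (h : ∀ k < n, ω' k = ω k) :
    |(codePoint c ω' 0 - codePoint c ω 0) / scale c n - (digitX (ω' n) - digitX (ω n))| ≤
      cellSize (c n) :=
  abs_codeCoord_sub_le (fun _ => abs_digitX_le_bound) h

lemma abs_codePoint_one_sub_le {c : ℕ → ℕ} {ω ω' : Code c} {n : ℕ} (h : ∀ k < n, ω' k = ω k) :
    |(codePoint c ω' 1 - codePoint c ω 1) / scale c n - (digitY (ω' n) - digitY (ω n))| ≤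
      cellSize (c n) :=
  abs_codeCoord_sub_le (fun _ => abs_digitY_le_bound) h

/-- The codes that agree with `ω` before position `n`. -/
def cyl {c : ℕ → ℕ} (ω : Code c) (n : ℕ) : Set (Code c) := {ω' | ∀ k < n, ω' k = ω k}

/-- The distribution of independent digits. -/
noncomputable def codeMeasure (c : ℕ → ℕ) : Measure (Code c) :=
  Measure.infinitePi fun n => digitMeasure (c n)

instance (c : ℕ → ℕ) : IsProbabilityMeasure (codeMeasure c) := by
  unfold codeMeasure; infer_instance

lemma codeMeasure_cyl_inter {c : ℕ → ℕ} (ω : Code c) (n : ℕ) (S : Set (Digit (c n))) :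
    codeMeasure c {ω' | ω' ∈ cyl ω n ∧ ω' n ∈ S} =
      codeMeasure c (cyl ω n) * digitMeasure (c n) S := by
  classical
  have key : ∀ (N : ℕ) (T : ∀ k, Set (Digit (c k))),
      codeMeasure c {ω' | ∀ k < N, ω' k ∈ T k} =
        ∏ k ∈ Finset.range N, digitMeasure (c k) (T k) := by
    intro N T
    have := Measure.infinitePi_pi (μ := fun n => digitMeasure (c n)) (s := Finset.range N) (t := T)
      fun i _ => MeasurableSet.of_discrete
    rw [← this, codeMeasure]
    congr 1
    ext ω'
    simp
  have h1 : cyl ω n = {ω' | ∀ k < n, ω' k ∈ ({ω k} : Set (Digit (c k)))} := rfl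
  have h2 : {ω' | ω' ∈ cyl ω n ∧ ω' n ∈ S} =
      {ω' | ∀ k < n + 1, ω' k ∈ Function.update (fun k => ({ω k} : Set (Digit (c k)))) n S k} := by
    ext ω'
    simp only [cyl, Set.mem_ofPred_eq, Nat.forall_lt_succ_right, Function.update_self]
    refine and_congr_left fun _ => forall₂_congr fun k hk => ?_
    rw [Function.update_of_ne hk.ne]; rfl
  rw [h2, key, h1, key, Finset.prod_range_succ, Function.update_self]
  congr 1
  refine Finset.prod_congr rfl fun k hk => ?_
  rw [Function.update_of_ne (Finset.mem_range.1 hk).ne]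

lemma codeMeasure_cyl_succ {c : ℕ → ℕ} (ω : Code c) (n : ℕ) :
    codeMeasure c (cyl ω (n + 1)) = codeMeasure c (cyl ω n) * digitMeasure (c n) {ω n} := by
  rw [← codeMeasure_cyl_inter]
  congr 1
  ext ω'
  simp only [cyl, Set.mem_ofPred_eq, Nat.forall_lt_succ_right, Set.mem_singleton_iff]

lemma codeMeasure_cyl_add_le {c : ℕ → ℕ} (ω : Code c) (n j : ℕ) :
    codeMeasure c (cyl ω (n + j)) ≤ codeMeasure c (cyl ω n) * 2⁻¹ ^ j := by
  induction j with
  | zero => simp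
  | succ j ih =>
    rw [← add_assoc, codeMeasure_cyl_succ, pow_succ, ← mul_assoc]
    exact mul_le_mul' ih (digitMeasure_singleton_le _)

lemma Plane.dist_eq_sqrt (p q : Plane) :
    dist p q = √((p 0 - q 0) ^ 2 + (p 1 - q 1) ^ 2) := by
  rw [EuclideanSpace.dist_eq, Fin.sum_univ_two, Real.dist_eq, Real.dist_eq, sq_abs, sq_abs]

lemma Plane.abs_sub_le_dist (p q : Plane) (i : Fin 2) : |p i - q i| ≤ dist p q := by
  rw [dist_eq_norm]
  exact PiLp.norm_apply_le (p - q) i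

/-- The codes of points at distance at most `r`. -/
def nearCodes {c : ℕ → ℕ} (ω : Code c) (r : ℝ) : Set (Code c) :=
  {ω' | dist (codePoint c ω') (codePoint c ω) ≤ r}

/-- The codes that first differ from `ω` at position `n` and whose points lie in a flat cone. -/
def flatCodes {c : ℕ → ℕ} (C : ℕ) (ω : Code c) (n : ℕ) : Set (Code c) :=
  {ω' | ω' ∈ cyl ω n ∧ ω' n ≠ ω n ∧
    |codePoint c ω' 1 - codePoint c ω 1| ≤ C * |codePoint c ω' 0 - codePoint c ω 0|}

section Code

variable {c : ℕ → ℕ}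

lemma flatCodes_height {C : ℕ} {ω ω' : Code c} {n : ℕ} (hC : C ≤ c n)
    (h : ω' ∈ flatCodes C ω n) :
    (ω' n).2 = !(ω n).2 ∧ ((ω n).1 : ℕ) + ((ω' n).1 : ℕ) ≤ c n * (2 * c n + 4) := by
  obtain ⟨h1, h2, h3⟩ := h
  refine height_add_le_of_flat (Ne.symm h2) (abs_codePoint_zero_sub_le h1)
    (abs_codePoint_one_sub_le h1) ?_
  have hs := scale_pos c n
  rw [abs_div, abs_div, abs_of_pos hs, ← mul_div_assoc]
  refine div_le_div_of_nonneg_right (h3.trans ?_) hs.le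
  exact mul_le_mul_of_nonneg_right (Nat.cast_le.2 hC) (abs_nonneg _)

lemma dist_le_dist_of_flatCodes {C : ℕ} {ω ω' ω'' : Code c} {n : ℕ} (hC : C ≤ c n)
    (h : ω' ∈ flatCodes C ω n) (h' : ω'' ∈ cyl ω n) (hb : (ω'' n).2 = (ω n).2)
    (h1 : ((ω n).1 : ℕ) ≤ (ω'' n).1) (h2 : ((ω'' n).1 : ℕ) ≤ 2 * (ω n).1 + (ω' n).1 + 1) :
    dist (codePoint c ω'') (codePoint c ω) ≤ dist (codePoint c ω') (codePoint c ω) := by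
  obtain ⟨h3, h4⟩ := flatCodes_height hC h
  have hs := scale_pos c n
  have := sq_add_sq_le_of_height h3 hb h4 h1 h2 (abs_codePoint_zero_sub_le h.1)
    (abs_codePoint_one_sub_le h.1) (abs_codePoint_zero_sub_le h') (abs_codePoint_one_sub_le h')
  rw [Plane.dist_eq_sqrt, Plane.dist_eq_sqrt]
  apply Real.sqrt_le_sqrt
  simp only [div_pow] at this
  rwa [← add_div, ← add_div, div_le_div_iff_of_pos_right (by positivity)] at this

/-- The mass of the part of a flat cone coming from one level. -/
lemma codeMeasure_flatCodes_le {C : ℕ} (ω : Code c) {n : ℕ} (hC : C ≤ c n) (r : ℝ) :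
    codeMeasure c (nearCodes ω r ∩ flatCodes C ω n) ≤
      (c n + 1 : ENNReal)⁻¹ * codeMeasure c (nearCodes ω r ∩ cyl ω n) := by
  rcases (nearCodes ω r ∩ flatCodes C ω n).eq_empty_or_nonempty with he | hne
  · rw [he]; simp
  obtain ⟨ω', ⟨hr, hf⟩, hmax⟩ : ∃ ω' ∈ nearCodes ω r ∩ flatCodes C ω n,
      ∀ ω₁ ∈ nearCodes ω r ∩ flatCodes C ω n, ((ω₁ n).1 : ℕ) ≤ (ω' n).1 := by
    obtain ⟨d, ⟨ω', h, rfl⟩, hd⟩ := Set.exists_max_image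
      ((fun ω₁ : Code c => ω₁ n) '' (nearCodes ω r ∩ flatCodes C ω n))
      (fun d => (d.1 : ℕ)) (Set.toFinite _) (hne.image _)
    exact ⟨ω', h, fun ω₁ h₁ => hd _ (Set.mem_image_of_mem _ h₁)⟩
  obtain ⟨h3, h4⟩ := flatCodes_height hC hf
  obtain ⟨m, hm1, hm2⟩ : ∃ m : Digit (c n), (m.1 : ℕ) = max (((ω' n).1 : ℕ) + 1) ((ω n).1 : ℕ) ∧
      m.2 = (ω n).2 :=
    ⟨(⟨max (((ω' n).1 : ℕ) + 1) ((ω n).1 : ℕ), by omega⟩, (ω n).2), rfl, rfl⟩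
  calc codeMeasure c (nearCodes ω r ∩ flatCodes C ω n)
      ≤ codeMeasure c {ω₁ | ω₁ ∈ cyl ω n ∧
          ω₁ n ∈ {d : Digit (c n) | d.2 = (!(ω n).2) ∧ (d.1 : ℕ) ≤ (ω' n).1}} := by
        refine measure_mono fun ω₁ h₁ => ?_
        exact ⟨h₁.2.1, (flatCodes_height hC h₁.2).1, hmax ω₁ h₁⟩
    _ ≤ codeMeasure c (cyl ω n) * ((c n + 1 : ENNReal)⁻¹ * digitMeasure (c n) {m}) := by
        rw [codeMeasure_cyl_inter]
        exact mul_le_mul_right (digitMeasure_le_of_height_lt _ _ m (by omega)) _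
    _ = (c n + 1 : ENNReal)⁻¹ * codeMeasure c {ω₁ | ω₁ ∈ cyl ω n ∧ ω₁ n ∈ ({m} : Set _)} := by
        rw [codeMeasure_cyl_inter]; ring
    _ ≤ _ := by
        have hsub : {ω₁ | ω₁ ∈ cyl ω n ∧ ω₁ n ∈ ({m} : Set _)} ⊆ nearCodes ω r ∩ cyl ω n := by
          intro ω₁ h₁
          refine ⟨?_, h₁.1⟩
          have e : ω₁ n = m := h₁.2
          exact (dist_le_dist_of_flatCodes hC hf h₁.1 (by rw [e, hm2]) (by rw [e]; omega)
            (by rw [e]; omega)).trans hr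
        exact mul_le_mul_right (measure_mono hsub) _

lemma digit_separated {k : ℕ} {d d' : Digit k} (h : d' ≠ d) :
    1 ≤ |digitX d' - digitX d| ∨ 1 ≤ |digitY d' - digitY d| := by
  have h0 : (0 : ℝ) ≤ k := k.cast_nonneg
  obtain ⟨i, b⟩ := d
  obtain ⟨j, b'⟩ := d'
  by_cases hb : b' = b
  · right
    subst hb
    have hij : (j : ℕ) ≠ i := fun e => h (by rw [Fin.ext e])
    have : (1 : ℤ) ≤ |(j : ℕ) - ((i : ℕ) : ℤ)| := by
      apply Int.one_le_abs; omega
    have h2 : (1 : ℝ) ≤ |((j : ℕ) : ℝ) - ((i : ℕ) : ℝ)| := by exact_mod_cast this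
    unfold digitY
    cases b'
    · simp only [Bool.false_eq_true, if_false]
      rwa [neg_sub_neg, abs_sub_comm]
    · simpa using h2
  · left
    unfold digitX
    have h1 : (1 : ℝ) ≤ |2 * (k : ℝ) + 4| := (le_abs_self _).trans' (by linarith)
    cases b <;> cases b'
    · exact absurd rfl hb
    · simpa using h1
    · simpa only [Bool.false_eq_true, if_false, if_true, zero_sub, abs_neg] using h1
    · exact absurd rfl hb

lemma scale_div_two_le_dist {ω ω' : Code c} {n : ℕ} (h : ω' ∈ cyl ω n) (hn : ω' n ≠ ω n) :
    scale c n / 2 ≤ dist (codePoint c ω') (codePoint c ω) := by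
  have hs := scale_pos c n
  have hl := cellSize_le (c n)
  have key : ∀ x y : ℝ, 1 ≤ |y| → |x / scale c n - y| ≤ cellSize (c n) → scale c n / 2 ≤ |x| := by
    intro x y h1 h2
    have h3 := abs_sub_abs_le_abs_sub y (x / scale c n)
    rw [abs_sub_comm] at h2
    have h4 : 1 / 2 ≤ |x / scale c n| := by linarith
    rw [abs_div, abs_of_pos hs, le_div_iff₀ hs] at h4
    linarith
  rcases digit_separated hn with h1 | h1
  · exact (key _ _ h1 (abs_codePoint_zero_sub_le h)).trans (Plane.abs_sub_le_dist _ _ 0)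
  · exact (key _ _ h1 (abs_codePoint_one_sub_le h)).trans (Plane.abs_sub_le_dist _ _ 1)

lemma exists_mem_cyl_of_ne {ω ω' : Code c} (h : ω' ≠ ω) : ∃ n, ω' ∈ cyl ω n ∧ ω' n ≠ ω n := by
  classical
  have h' := Function.ne_iff.1 h
  exact ⟨Nat.find h', fun k hk => not_not.1 (Nat.find_min h' hk), Nat.find_spec h'⟩

/-- The mass of a flat cone at small scales. -/
lemma codeMeasure_flat_le {C K N : ℕ} (hN : ∀ n ≥ N, C ≤ c n ∧ K ≤ c n) (ω : Code c) {r : ℝ}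
    (hr : r < scale c N / 2) :
    codeMeasure c {ω' | ω' ∈ nearCodes ω r ∧ ω' ≠ ω ∧
      |codePoint c ω' 1 - codePoint c ω 1| ≤ C * |codePoint c ω' 0 - codePoint c ω 0|} ≤
      4 * (K + 1 : ENNReal)⁻¹ * codeMeasure c (nearCodes ω r) := by
  classical
  by_cases hex : ∃ n, (nearCodes ω r ∩ flatCodes C ω n).Nonempty
  swap
  · have : {ω' | ω' ∈ nearCodes ω r ∧ ω' ≠ ω ∧
      |codePoint c ω' 1 - codePoint c ω 1| ≤ C * |codePoint c ω' 0 - codePoint c ω 0|} = ∅ := by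
      refine Set.eq_empty_of_forall_notMem fun ω' h => hex ?_
      obtain ⟨n, h1, h2⟩ := exists_mem_cyl_of_ne h.2.1
      exact ⟨n, ω', h.1, h1, h2, h.2.2⟩
    rw [this]; simp
  obtain ⟨M, ⟨ω₀, hr₀, hf₀⟩, hmin⟩ : ∃ M, (nearCodes ω r ∩ flatCodes C ω M).Nonempty ∧
      ∀ n < M, ¬ (nearCodes ω r ∩ flatCodes C ω n).Nonempty :=
    ⟨Nat.find hex, Nat.find_spec hex, fun n hn => Nat.find_min hex hn⟩
  have hNM : N ≤ M := by
    by_contra! hlt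
    have h1 := scale_div_two_le_dist hf₀.1 hf₀.2.1
    have h2 := scale_antitone c hlt.le
    have h3 : dist (codePoint c ω₀) (codePoint c ω) ≤ r := hr₀
    linarith
  have hcyl : cyl ω (M + 1) ⊆ nearCodes ω r := by
    intro ω₁ h₁
    have e : ω₁ M = ω M := h₁ M (Nat.lt_succ_self M)
    exact (dist_le_dist_of_flatCodes (hN M hNM).1 hf₀
      (fun k hk => h₁ k (hk.trans (Nat.lt_succ_self M)))
      (by rw [e]) (by rw [e]) (by rw [e]; omega)).trans hr₀
  have hlevel : ∀ j, codeMeasure c (nearCodes ω r ∩ flatCodes C ω (M + j)) ≤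
      2 * (K + 1 : ENNReal)⁻¹ * codeMeasure c (nearCodes ω r) * 2⁻¹ ^ j := by
    intro j
    have hK : (c (M + j) + 1 : ENNReal)⁻¹ ≤ (K + 1 : ENNReal)⁻¹ := by
      have : (K : ENNReal) ≤ c (M + j) := by exact_mod_cast (hN (M + j) (by omega)).2
      gcongr
    refine (codeMeasure_flatCodes_le ω (hN (M + j) (by omega)).1 r).trans ?_
    have h2 : codeMeasure c (nearCodes ω r ∩ cyl ω (M + j)) ≤
        codeMeasure c (nearCodes ω r) * (2 * 2⁻¹ ^ j) := by
      rcases j with _ | j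
      · refine (measure_mono Set.inter_subset_left).trans ?_
        rw [pow_zero, mul_one]
        exact le_mul_of_one_le_right' (by norm_num)
      · rw [pow_succ', ← mul_assoc 2, ENNReal.mul_inv_cancel (by simp) (by simp), one_mul]
        refine (measure_mono Set.inter_subset_right).trans ?_
        rw [show M + (j + 1) = M + 1 + j by ring]
        exact (codeMeasure_cyl_add_le ω (M + 1) j).trans
          (mul_le_mul_left (measure_mono hcyl) _)
    calc _ ≤ (K + 1 : ENNReal)⁻¹ * (codeMeasure c (nearCodes ω r) * (2 * 2⁻¹ ^ j)) :=
          mul_le_mul' hK h2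
      _ = _ := by ring
  calc _ ≤ codeMeasure c (⋃ j, nearCodes ω r ∩ flatCodes C ω (M + j)) := by
        refine measure_mono fun ω' h => ?_
        obtain ⟨n, h1, h2⟩ := exists_mem_cyl_of_ne h.2.1
        have h3 : ω' ∈ nearCodes ω r ∩ flatCodes C ω n := ⟨h.1, h1, h2, h.2.2⟩
        obtain ⟨j, rfl⟩ := Nat.exists_eq_add_of_le (not_lt.1 fun hlt => hmin n hlt ⟨ω', h3⟩)
        exact Set.mem_iUnion.2 ⟨j, h3⟩
    _ ≤ ∑' j, codeMeasure c (nearCodes ω r ∩ flatCodes C ω (M + j)) := measure_iUnion_le _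
    _ ≤ ∑' j, 2 * (K + 1 : ENNReal)⁻¹ * codeMeasure c (nearCodes ω r) * 2⁻¹ ^ j :=
        ENNReal.tsum_le_tsum hlevel
    _ = _ := by
        rw [ENNReal.tsum_mul_left, ENNReal.tsum_geometric, ENNReal.one_sub_inv_two, inv_inv]
        ring

/-- A set of codes that misses a digit in every cylinder is null, if the smallest weights
decrease slowly. -/
lemma codeMeasure_eq_zero_of_missing (hc : ∀ n, totalWeight (c n) ≤ n + 6) {E : Set (Code c)}
    (hE : ∀ ω : Code c, ∀ n, ∃ d : Digit (c n), ∀ ω' ∈ E ∩ cyl ω n, ω' n ≠ d) :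
    codeMeasure c E = 0 := by
  classical
  have key : ∀ j m (ω : Code c), codeMeasure c (E ∩ cyl ω m) * ((m + 5 + j : ℕ) : ENNReal) ≤
      codeMeasure c (cyl ω m) * ((m + 5 : ℕ) : ENNReal) := by
    intro j
    induction j with
    | zero => intro m ω; gcongr; exact Set.inter_subset_right
    | succ j ih =>
      intro m ω
      obtain ⟨d₀, hd₀⟩ := hE ω m
      have hsum : ((∑ d ∈ Finset.univ.erase d₀, digitMeasure (c m) {d}) *
          ((m + 6 : ℕ) : ENNReal)) ≤ ((m + 5 : ℕ) : ENNReal) := by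
        have h1 : ∑ d, digitMeasure (c m) {d} = 1 := by
          have := sum_measure_singleton (μ := digitMeasure (c m)) (s := Finset.univ)
          rw [this, Finset.coe_univ, measure_univ]
        rw [← Finset.add_sum_erase _ _ (Finset.mem_univ d₀)] at h1
        have h2 : 1 ≤ digitMeasure (c m) {d₀} * ((m + 6 : ℕ) : ENNReal) :=
          (one_le_digitMeasure_singleton_mul d₀).trans (by gcongr; exact hc m)
        have h3 := congrArg (· * ((m + 6 : ℕ) : ENNReal)) h1
        simp only [one_mul, add_mul] at h3
        have h4 : 1 + (∑ d ∈ Finset.univ.erase d₀, digitMeasure (c m) {d}) *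
            ((m + 6 : ℕ) : ENNReal) ≤ 1 + ((m + 5 : ℕ) : ENNReal) := by
          refine (add_le_add_left h2 _).trans (h3.le.trans ?_)
          push_cast; ring_nf; rfl
        exact (ENNReal.add_le_add_iff_left ENNReal.one_ne_top).1 h4
      have hcov : E ∩ cyl ω m ⊆ ⋃ d ∈ Finset.univ.erase d₀,
          E ∩ cyl (Function.update ω m d) (m + 1) := by
        intro ω' h
        simp only [Set.mem_iUnion]
        refine ⟨ω' m, Finset.mem_erase.2 ⟨hd₀ ω' h, Finset.mem_univ _⟩, h.1, fun k hk => ?_⟩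
        rcases Nat.lt_succ_iff_lt_or_eq.1 hk with hk | rfl
        · rw [Function.update_of_ne hk.ne]; exact h.2 k hk
        · rw [Function.update_self]
      have hcyl : ∀ d, codeMeasure c (cyl (Function.update ω m d) (m + 1)) =
          codeMeasure c (cyl ω m) * digitMeasure (c m) {d} := by
        intro d
        rw [codeMeasure_cyl_succ, Function.update_self]
        congr 2
        ext ω'
        exact forall₂_congr fun k hk => by rw [Function.update_of_ne hk.ne]
      calc codeMeasure c (E ∩ cyl ω m) * ((m + 5 + (j + 1) : ℕ) : ENNReal)
          ≤ (∑ d ∈ Finset.univ.erase d₀,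
              codeMeasure c (E ∩ cyl (Function.update ω m d) (m + 1))) *
              ((m + 1 + 5 + j : ℕ) : ENNReal) := by
            rw [show m + 5 + (j + 1) = m + 1 + 5 + j by ring]
            gcongr
            exact (measure_mono hcov).trans (measure_biUnion_finset_le _ _)
        _ ≤ ∑ d ∈ Finset.univ.erase d₀, codeMeasure c (cyl ω m) * digitMeasure (c m) {d} *
              ((m + 6 : ℕ) : ENNReal) := by
            rw [Finset.sum_mul]
            refine Finset.sum_le_sum fun d _ => ?_
            rw [← hcyl]
            exact ih (m + 1) _
        _ = codeMeasure c (cyl ω m) * ((∑ d ∈ Finset.univ.erase d₀, digitMeasure (c m) {d}) *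
              ((m + 6 : ℕ) : ENNReal)) := by
            rw [← Finset.sum_mul, ← Finset.mul_sum, mul_assoc]
        _ ≤ _ := by gcongr
  obtain ⟨ω⟩ : Nonempty (Code c) := ⟨fun _ => (0, true)⟩
  have huniv : cyl ω 0 = Set.univ := by ext; simp [cyl]
  by_contra hne
  have hfin : codeMeasure c E ≠ ⊤ := measure_ne_top _ _
  obtain ⟨j, hj⟩ := ENNReal.exists_nat_mul_gt hne (b := 5) (by simp)
  have := key j 0 ω
  rw [huniv, Set.inter_univ, measure_univ, one_mul] at this
  refine absurd (hj.trans_le (le_trans ?_ this)) (by norm_num)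
  rw [mul_comm]
  gcongr
  omega

end Code

/-- The set is contained in a double cone around a coordinate axis at each of its points. -/
def IsSteepOrFlat (E : Set Plane) : Prop :=
  (∀ u ∈ E, ∀ v ∈ E, |u 0 - v 0| ≤ 2 * |u 1 - v 1|) ∨
    ∀ u ∈ E, ∀ v ∈ E, |u 1 - v 1| ≤ 2 * |u 0 - v 0|

lemma codeMeasure_preimage_eq_zero {c : ℕ → ℕ} (hc : ∀ n, totalWeight (c n) ≤ n + 6)
    {E : Set Plane} (hE : IsSteepOrFlat E) : codeMeasure c (codePoint c ⁻¹' E) = 0 := by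
  refine codeMeasure_eq_zero_of_missing hc fun ω n => ?_
  have hs := scale_pos c n
  have hl := cellSize_le (c n)
  have h0 : (0 : ℝ) ≤ c n := Nat.cast_nonneg _
  have key : ∀ (i : Fin 2) (x y : ℝ) (u v : Plane), |u i - v i| ≤ 2 * |x - y| →
      |(u i - v i) / scale c n| ≤ 2 * |(x - y) / scale c n| := by
    intro i x y u v h
    rw [abs_div, abs_div, abs_of_pos hs, ← mul_div_assoc]
    exact div_le_div_of_nonneg_right h hs.le
  by_contra! hcon
  have hpair : ∀ d d' : Digit (c n), ∃ u ∈ E, ∃ v ∈ E,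
      |(u 0 - v 0) / scale c n - (digitX d - digitX d')| ≤ 1 / 4 ∧
      |(u 1 - v 1) / scale c n - (digitY d - digitY d')| ≤ 1 / 4 := by
    intro d d'
    obtain ⟨ω₁, ⟨hE₁, h₁⟩, rfl⟩ := hcon d
    obtain ⟨ω₂, ⟨hE₂, h₂⟩, rfl⟩ := hcon d'
    have h : ∀ k < n, ω₁ k = ω₂ k := fun k hk => (h₁ k hk).trans (h₂ k hk).symm
    exact ⟨_, hE₁, _, hE₂, (abs_codePoint_zero_sub_le h).trans hl,
      (abs_codePoint_one_sub_le h).trans hl⟩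
  rcases hE with hE | hE
  · obtain ⟨u, hu, v, hv, hx, hy⟩ := hpair (0, true) (0, false)
    have h := key 0 _ _ u v (hE u hu v hv)
    have e1 : digitX ((0, true) : Digit (c n)) - digitX ((0, false) : Digit (c n)) =
      2 * c n + 4 := by simp [digitX]
    have e2 : digitY ((0, true) : Digit (c n)) - digitY ((0, false) : Digit (c n)) = 0 := by
      simp [digitY]
    rw [e1, abs_le] at hx
    rw [e2, sub_zero] at hy
    have := le_abs_self ((u 0 - v 0) / scale c n)
    linarith
  · obtain ⟨u, hu, v, hv, hx, hy⟩ := hpair (1, true) (0, true)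
    have h := key 1 _ _ u v (hE u hu v hv)
    have e1 : digitX ((1, true) : Digit (c n)) - digitX ((0, true) : Digit (c n)) = 0 := by
      simp [digitX]
    have e2 : digitY ((1, true) : Digit (c n)) - digitY ((0, true) : Digit (c n)) = 1 := by
      simp [digitY]
    rw [e1, sub_zero] at hx
    rw [e2, abs_le] at hy
    have := le_abs_self ((u 1 - v 1) / scale c n)
    linarith

lemma IsC1Curve.exists_isSteepOrFlat {γ : ℝ → Plane} (hγ : IsC1Curve γ) (t : ℝ) :
    ∃ ε > 0, IsSteepOrFlat (γ '' Metric.closedBall t ε) := by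
  have hd : HasStrictDerivAt γ (deriv γ t) t :=
    hγ.contDiff.contDiffAt.hasStrictDerivAt one_ne_zero
  have key : ∀ i j : Fin 2, deriv γ t i ≠ 0 → |deriv γ t j| ≤ |deriv γ t i| →
      ∃ ε > 0, ∀ u ∈ γ '' Metric.closedBall t ε, ∀ v ∈ γ '' Metric.closedBall t ε,
        |u j - v j| ≤ 2 * |u i - v i| := by
    intro i j hi hji
    have hM : 0 < |deriv γ t i| := abs_pos.2 hi
    obtain ⟨ε, hε, h⟩ := Metric.eventually_nhds_iff.1
      (hd.isLittleO.def (c := |deriv γ t i| / 4) (by positivity))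
    refine ⟨ε / 2, by positivity, ?_⟩
    rintro _ ⟨a, ha, rfl⟩ _ ⟨b, hb, rfl⟩
    rw [Metric.mem_closedBall] at ha hb
    have hab := @h (a, b) (by
      rw [Prod.dist_eq]
      exact max_lt (by simp only; linarith) (by simp only; linarith))
    have hcoord : ∀ l : Fin 2, |γ a l - γ b l - (a - b) * deriv γ t l| ≤
        |deriv γ t i| / 4 * |a - b| := fun l => by
      have := (PiLp.norm_apply_le _ l).trans hab
      simpa [Real.norm_eq_abs] using this
    have h1 := hcoord i
    have h2 := hcoord j
    have h3 := abs_sub_abs_le_abs_sub ((a - b) * deriv γ t i) (γ a i - γ b i)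
    rw [abs_sub_comm] at h1
    have h4 := abs_sub_abs_le_abs_sub (γ a j - γ b j) ((a - b) * deriv γ t j)
    rw [abs_mul] at h3 h4
    have h5 := mul_le_mul_of_nonneg_left hji (abs_nonneg (a - b))
    nlinarith [mul_nonneg (abs_nonneg (a - b)) hM.le]
  have hne := hγ.deriv_ne_zero t
  rcases le_total |deriv γ t 0| |deriv γ t 1| with h | h
  · obtain ⟨ε, hε, h'⟩ := key 1 0 (fun h1 => hne (by
      rw [h1, abs_zero] at h
      have h0 := abs_eq_zero.1 (le_antisymm h (abs_nonneg _))
      ext l; fin_cases l <;> simpa)) h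
    exact ⟨ε, hε, Or.inl h'⟩
  · obtain ⟨ε, hε, h'⟩ := key 0 1 (fun h1 => hne (by
      rw [h1, abs_zero] at h
      have h0 := abs_eq_zero.1 (le_antisymm h (abs_nonneg _))
      ext l; fin_cases l <;> simpa)) h
    exact ⟨ε, hε, Or.inr h'⟩

/-- The distribution of the point with independent random digits. -/
noncomputable def pointMeasure (c : ℕ → ℕ) : Measure Plane := (codeMeasure c).map (codePoint c)

lemma measurable_codePoint (c : ℕ → ℕ) : Measurable (codePoint c) :=
  (continuous_codePoint c).measurable

instance (c : ℕ → ℕ) : IsProbabilityMeasure (pointMeasure c) :=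
  Measure.isProbabilityMeasure_map (measurable_codePoint c).aemeasurable

lemma purelyOneUnrectifiable_pointMeasure {c : ℕ → ℕ} (hc : ∀ n, totalWeight (c n) ≤ n + 6) :
    PurelyOneUnrectifiable (pointMeasure c) := by
  rintro A ⟨γ, hγ, hA⟩
  refine measure_mono_null hA (measure_iUnion_null fun i => ?_)
  choose ε hε h using (hγ i).exists_isSteepOrFlat
  obtain ⟨s, hs, hs'⟩ := TopologicalSpace.countable_cover_nhds
    (f := fun t => Metric.closedBall t (ε t)) fun t => Metric.closedBall_mem_nhds t (hε t)
  rw [← Set.image_univ, ← hs', Set.image_iUnion₂]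
  refine (measure_biUnion_null_iff hs).2 fun t _ => ?_
  have hcomp : IsCompact (γ i '' Metric.closedBall t (ε t)) :=
    (isCompact_closedBall _ _).image (hγ i).contDiff.continuous
  rw [pointMeasure, Measure.map_apply (measurable_codePoint c) hcomp.measurableSet]
  exact codeMeasure_preimage_eq_zero hc (h t)

/-- The horizontal axis. -/
noncomputable def horizontalAxis : Submodule ℝ Plane :=
  Submodule.span ℝ {EuclideanSpace.single 0 1}

lemma isLine_horizontalAxis : IsLine horizontalAxis :=
  finrank_span_singleton (by simp)

lemma abs_one_le_infDist_horizontalAxis (v : Plane) :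
    |v 1| ≤ Metric.infDist v (horizontalAxis : Set Plane) := by
  refine (Metric.le_infDist ⟨0, horizontalAxis.zero_mem⟩).2 fun w hw => ?_
  have e : w 1 = 0 := by
    obtain ⟨a, rfl⟩ := Submodule.mem_span_singleton.1 hw
    simp
  have h := Plane.abs_sub_le_dist v w 1
  rwa [e, sub_zero] at h

lemma ne_and_abs_le_of_mem_cone {x y : Plane} {α : ℝ} {C : ℕ} (h0 : 0 < α) (h1 : α < 1)
    (hC : 1 / (1 - α) ≤ C) (h : y ∈ cone x horizontalAxis α) :
    y ≠ x ∧ |y 1 - x 1| ≤ C * |y 0 - x 0| := by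
  have h2 : |y 1 - x 1| < α * dist y x := by
    rw [dist_eq_norm]
    exact (abs_one_le_infDist_horizontalAxis (y - x)).trans_lt h
  refine ⟨?_, ?_⟩
  · rintro rfl
    simp at h2
  · rw [div_le_iff₀ (by linarith)] at hC
    have h3 : dist y x ≤ |y 0 - x 0| + |y 1 - x 1| := by
      rw [Plane.dist_eq_sqrt]
      refine Real.sqrt_le_iff.2 ⟨by positivity, ?_⟩
      rw [← sq_abs (y 0 - x 0), ← sq_abs (y 1 - x 1)]
      nlinarith [abs_nonneg (y 0 - x 0), abs_nonneg (y 1 - x 1)]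
    have h4 := mul_le_mul_of_nonneg_left h3 h0.le
    have h5 : (1 - α) * |y 1 - x 1| ≤ |y 0 - x 0| := by
      nlinarith [abs_nonneg (y 0 - x 0)]
    have h6 := mul_le_mul_of_nonneg_left h5 (Nat.cast_nonneg C : (0 : ℝ) ≤ C)
    nlinarith [abs_nonneg (y 1 - x 1)]

lemma measurableSet_truncCone (x : Plane) (r : ℝ) (V : Submodule ℝ Plane) (α : ℝ) :
    MeasurableSet (truncCone x r V α) := by
  refine Metric.isClosed_closedBall.measurableSet.inter ?_
  refine (isOpen_lt ?_ ?_).measurableSet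
  · exact (Metric.continuous_infDist_pt _).comp (continuous_id.sub continuous_const)
  · fun_prop

lemma tendsto_pointMeasure_truncCone {c : ℕ → ℕ} (hc : Tendsto c atTop atTop) {α : ℝ}
    (h0 : 0 < α) (h1 : α < 1) (ω : Code c) :
    Tendsto (fun r : ℝ => pointMeasure c (truncCone (codePoint c ω) r horizontalAxis α) /
      pointMeasure c (Metric.closedBall (codePoint c ω) r)) (𝓝[>] 0) (𝓝 0) := by
  rw [ENNReal.tendsto_nhds_zero]
  intro δ hδ
  obtain ⟨C, hC⟩ := exists_nat_ge (1 / (1 - α))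
  obtain ⟨K, hK⟩ : ∃ K : ℕ, 4 * (K + 1 : ENNReal)⁻¹ ≤ δ := by
    obtain ⟨K, hK⟩ := ENNReal.exists_inv_nat_lt
      (ENNReal.div_pos hδ.ne' (by simp : (4 : ENNReal) ≠ ⊤)).ne'
    refine ⟨K, ?_⟩
    have h2 : (K + 1 : ENNReal)⁻¹ ≤ δ / 4 :=
      (ENNReal.inv_le_inv.2 le_self_add).trans hK.le
    calc _ ≤ 4 * (δ / 4) := by gcongr
      _ = δ := ENNReal.mul_div_cancel (by simp) (by simp)
  obtain ⟨N, hN⟩ := eventually_atTop.1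
    ((hc.eventually_ge_atTop C).and (hc.eventually_ge_atTop K))
  have hpos : 0 < scale c N / 2 := half_pos (scale_pos c N)
  filter_upwards [Ioo_mem_nhdsGT hpos] with r hr
  rw [pointMeasure, Measure.map_apply (measurable_codePoint c) (measurableSet_truncCone _ _ _ _),
    Measure.map_apply (measurable_codePoint c) Metric.isClosed_closedBall.measurableSet]
  refine ENNReal.div_le_of_le_mul ?_
  refine le_trans (measure_mono fun ω' h => ?_)
    ((codeMeasure_flat_le hN ω hr.2).trans (mul_le_mul_left hK _))
  obtain ⟨h2, h3⟩ := ne_and_abs_le_of_mem_cone h0 h1 hC h.2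
  exact ⟨h.1, fun e => h2 (by rw [e]), h3⟩

lemma ae_pointMeasure_of_forall {c : ℕ → ℕ} {p : Plane → Prop} (h : ∀ ω, p (codePoint c ω)) :
    ∀ᵐ x ∂pointMeasure c, p x := by
  have hm : MeasurableSet (Set.range (codePoint c)) :=
    (isCompact_range (continuous_codePoint c)).measurableSet
  filter_upwards [ae_map_mem_range (codePoint c) hm (codeMeasure c)] with x hx
  obtain ⟨ω, rfl⟩ := hx
  exact h ω

lemma exists_slow_sequence :
    ∃ c : ℕ → ℕ, (∀ n, totalWeight (c n) ≤ n + 6) ∧ Tendsto c atTop atTop := by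
  refine ⟨fun n => Nat.findGreatest (fun k => totalWeight k ≤ n + 6) n, fun n => ?_, ?_⟩
  · exact Nat.findGreatest_spec (P := fun k => totalWeight k ≤ n + 6) (Nat.zero_le n)
      (by rw [totalWeight_zero]; omega)
  · refine tendsto_atTop.2 fun K => eventually_atTop.2 ⟨max K (totalWeight K), fun n hn => ?_⟩
    exact Nat.le_findGreatest (by omega) (by omega)

theorem mainTheorem4 :
    ∃ (ℓ : Submodule ℝ Plane) (μ : Measure Plane),
      IsLine ℓ ∧ IsFiniteMeasure μ ∧ μ ≠ 0 ∧ PurelyOneUnrectifiable μ ∧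
      ∀ α : ℝ, 0 < α → α < 1 →
        ∀ᵐ x ∂μ, Tendsto (fun r : ℝ => μ (truncCone x r ℓ α) / μ (Metric.closedBall x r))
          (𝓝[>] 0) (𝓝 0) := by
  obtain ⟨c, hc, hc'⟩ := exists_slow_sequence
  exact ⟨horizontalAxis, pointMeasure c, isLine_horizontalAxis, inferInstance,
    IsProbabilityMeasure.ne_zero _, purelyOneUnrectifiable_pointMeasure hc,
    fun α h0 h1 => ae_pointMeasure_of_forall (tendsto_pointMeasure_truncCone hc' h0 h1)⟩
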